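/- Let $GF(q)$ be a finite field of cardinality $q$, let $N\ge 1$ be an integer, let $\mathbf V$ be a vector space over $GF(q)$ of dimension $N$, and let $X$ be the set of subspaces of $\mathbf V$, partially ordered by inclusion; for $y,z\in X$ we say that $y$ covers $z$ if $z\subsetneq y$ and no $w\in X$ satisfies $z\subsetneq w\subsetneq y$. Let ${\rm Mat}_X(\mathbb C)$ be the algebra of complex matrices with rows and columns indexed by $X$, acting on $V=\mathbb C^X$ by left multiplication, and let $\varphi$ be a positive real number. Define the following matrices in ${\rm Mat}_X(\mathbb C)$. - $A^*$ is diagonal with $(y,y)$-entry $q^{-\dim y}$. For $0\le i\le N$, $E^*_i$ is diagonal with $(y,y)$-entry $1$ if $\dim y=i$ and $0$ otherwise. - $R$ has $(y,z)$-entry $1$ if $y$ covers $z$ and $0$ otherwise. $L$ has $(y,z)$-entry $1$ if $z$ covers $y$ and $0$ otherwise. - $A$ has $(y,z)$-entry $1$ if $y$ covers $z$; $\varphi q^{\dim y}$ if $z$ covers $y$; $\frac{\varphi-1}{q-1}q^{\dim y}$ if $y=z$; and $0$ otherwise. - $A^+=\frac{(A^*)^{-1}}{q-1}-R$, $\quad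 A^-=\frac{(A^*)^{-1}}{q-1}+(A^*)^{-1}L$, $\quad A_+=\frac{(A^*)^{-1}}{q-1}+\varphi^{-1}R$, $\quad A_-=\frac{(A^*)^{-1}}{q-1}-\varphi(A^*)^{-1}L$. For $0\le i\le N$ put $\theta_i=\dfrac{\varphi q^{N-i}-q^i}{q-1}$. For a diagonalizable matrix $B$ and an eigenvalue $\theta$ of $B$, the primitive idempotent of $B$ for $\theta$ is the matrix that acts as the identity on the $\theta$-eigenspace of $B$ and as zero on every other eigenspace of $B$. For $0\le i\le N$ let $U_i^{\downarrow\downarrow}$, $U_i^{\uparrow\downarrow}$, $U_i^{\downarrow\uparrow}$, $U_i^{\uparrow\uparrow}$ denote the eigenspaces in $V$, for the scalar $q^i/(q-1)$, of $A^-$, $A^+$, $A_-$, $A_+$, respectively. Then all these subspaces are nonzero, and each of the following sums is direct: $$V=\sum_{i=0}^N U_i^{\downarrow\downarrow},\qquad V=\sum_{i=0}^N U_i^{\uparrow\downarrow},\qquad V=\sum_{i=0}^N U_i^{\downarrow\uparrow},\qquad V=\sum_{i=0}^N U_i^{\uparrow\uparrow}.$$ The matrix $A$ is diagonalizable and each $\theta_i$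 $(0\le i\le N)$ is an eigenvalue of $A$, so that $A$ has a unique primitive idempotent $E_i$ for $\theta_i$. Moreover, for $0\le i\le N$, $$\begin{aligned} U_i^{\downarrow\downarrow}&=(E^*_0V+E^*_1V+\cdots+E^*_iV)\cap(E_0V+E_1V+\cdots+E_{N-i}V),\\ U_i^{\uparrow\downarrow}&=(E^*_NV+E^*_{N-1}V+\cdots+E^*_iV)\cap(E_0V+E_1V+\cdots+E_iV),\\ U_i^{\downarrow\uparrow}&=(E^*_0V+E^*_1V+\cdots+E^*_iV)\cap(E_NV+E_{N-1}V+\cdots+E_iV),\\ U_i^{\uparrow\uparrow}&=(E^*_NV+E^*_{N-1}V+\cdots+E^*_iV)\cap(E_NV+E_{N-1}V+\cdots+E_{N-i}V). \end{aligned}$$ -/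

import Mathlib

namespace ProjGeom

open Module

/-- A finite-dimensional vector space over a finite field has finitely many subspaces.
The elements of `Submodule F W` are the vertices of the projective geometry, ordered by inclusion. -/
noncomputable instance instFintypeSubmodule {F W : Type*} [Field F] [Finite F] [AddCommGroup W]
    [Module F W] [FiniteDimensional F W] : Fintype (Submodule F W) :=
  haveI : Finite W := Module.finite_of_finite F
  Fintype.ofFinite _

section Geometry

variable (F W : Type*) [Field F] [Finite F] [AddCommGroup W] [Module F W] [FiniteDimensional F W]

/-- Square complex matrices indexed by the subspaces of `W`. -/
abbrev Mat : Type _ := Matrix (Submodule F W) (Submodule F W) ℂ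

/-- The standard module: complex column vectors indexed by the subspaces of `W`. -/
abbrev Std : Type _ := Submodule F W → ℂ

/-- The cardinality `q` of the finite field, as a complex number. -/
noncomputable def q : ℂ := (Nat.card F : ℂ)

open Classical in
/-- The diagonal matrix `E*_i`, the indicator of the subspaces of dimension `i`. -/
noncomputable def Estar (i : ℕ) : Mat F W :=
  Matrix.diagonal fun y => if finrank F y = i then 1 else 0

open Classical in
/-- The diagonal matrix `A*` with `(y,y)`-entry `q ^ (-dim y)`. -/
noncomputable def Astar : Mat F W :=
  Matrix.diagonal fun y => (q F ^ finrank F y)⁻¹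

open Classical in
/-- The raising matrix: the `(y,z)`-entry is `1` if `y` covers `z`, and `0` otherwise. -/
noncomputable def R : Mat F W :=
  Matrix.of fun y z => if z ⋖ y then 1 else 0

open Classical in
/-- The lowering matrix: the `(y,z)`-entry is `1` if `z` covers `y`, and `0` otherwise. -/
noncomputable def L : Mat F W :=
  Matrix.of fun y z => if y ⋖ z then 1 else 0

open Classical in
/-- The weighted adjacency matrix `A` with parameter `φ`. -/
noncomputable def A (φ : ℝ) : Mat F W :=
  Matrix.of fun y z =>
    if z ⋖ y then 1
    else if y ⋖ z then (φ : ℂ) * q F ^ finrank F y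
    else if y = z then ((φ : ℂ) - 1) / (q F - 1) * q F ^ finrank F y
    else 0

open Classical in
/-- `A⁺ = (A*)⁻¹ / (q - 1) - R`. -/
noncomputable def Asup_plus : Mat F W :=
  (q F - 1)⁻¹ • (Astar F W)⁻¹ - R F W

open Classical in
/-- `A⁻ = (A*)⁻¹ / (q - 1) + (A*)⁻¹ L`. -/
noncomputable def Asup_minus : Mat F W :=
  (q F - 1)⁻¹ • (Astar F W)⁻¹ + (Astar F W)⁻¹ * L F W

open Classical in
/-- `A₊ = (A*)⁻¹ / (q - 1) + φ⁻¹ R`. -/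
noncomputable def Asub_plus (φ : ℝ) : Mat F W :=
  (q F - 1)⁻¹ • (Astar F W)⁻¹ + (φ : ℂ)⁻¹ • R F W

open Classical in
/-- `A₋ = (A*)⁻¹ / (q - 1) - φ (A*)⁻¹ L`. -/
noncomputable def Asub_minus (φ : ℝ) : Mat F W :=
  (q F - 1)⁻¹ • (Astar F W)⁻¹ - (φ : ℂ) • ((Astar F W)⁻¹ * L F W)

/-- `θ_i = (φ q ^ (N - i) - q ^ i) / (q - 1)`, used for `0 ≤ i ≤ N`. -/
noncomputable def theta (φ : ℝ) (N i : ℕ) : ℂ :=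
  ((φ : ℂ) * q F ^ (N - i) - q F ^ i) / (q F - 1)

end Geometry

section LinearAlgebra

variable {X : Type*} [Fintype X]

open Classical in
/-- The eigenspace `{v | B v = μ v}` of a square complex matrix. -/
noncomputable def eigSpace (B : Matrix X X ℂ) (μ : ℂ) : Submodule ℂ (X → ℂ) :=
  Module.End.eigenspace (Matrix.toLin' B) μ

open Classical in
/-- The subspace `B V = {B v | v ∈ V}` of the space `V` of column vectors. -/
noncomputable def imageSpace (B : Matrix X X ℂ) : Submodule ℂ (X → ℂ) :=
  LinearMap.range (Matrix.toLin' B)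

/-- `B` is diagonalizable: the space of column vectors is spanned by the eigenspaces of `B`. -/
def IsDiagonalizable (B : Matrix X X ℂ) : Prop :=
  (⨆ μ : ℂ, eigSpace B μ) = ⊤

/-- `E` is the primitive idempotent for the diagonalizable matrix `B` and its eigenvalue `θ`:
it acts as the identity on the `θ`-eigenspace and as zero on every other eigenspace. -/
structure IsPrimitiveIdempotent (B : Matrix X X ℂ) (θ : ℂ) (E : Matrix X X ℂ) : Prop where
  diagonalizable : IsDiagonalizable B
  eigenvalue : eigSpace B θ ≠ ⊥
  apply_self : ∀ v ∈ eigSpace B θ, E.mulVec v = v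
  apply_other : ∀ μ : ℂ, μ ≠ θ → ∀ v ∈ eigSpace B μ, E.mulVec v = 0

end LinearAlgebra

section Split

variable (F W : Type*) [Field F] [Finite F] [AddCommGroup W] [Module F W] [FiniteDimensional F W]

/-- `U_i^{↓↓}`: the eigenspace of `A⁻` for `q ^ i / (q - 1)`. -/
noncomputable def Udd (i : ℕ) : Submodule ℂ (Std F W) :=
  eigSpace (Asup_minus F W) (q F ^ i / (q F - 1))

/-- `U_i^{↑↓}`: the eigenspace of `A⁺` for `q ^ i / (q - 1)`. -/
noncomputable def Uud (i : ℕ) : Submodule ℂ (Std F W) :=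
  eigSpace (Asup_plus F W) (q F ^ i / (q F - 1))

/-- `U_i^{↓↑}`: the eigenspace of `A₋` for `q ^ i / (q - 1)`. -/
noncomputable def Udu (φ : ℝ) (i : ℕ) : Submodule ℂ (Std F W) :=
  eigSpace (Asub_minus F W φ) (q F ^ i / (q F - 1))

/-- `U_i^{↑↑}`: the eigenspace of `A₊` for `q ^ i / (q - 1)`. -/
noncomputable def Uuu (φ : ℝ) (i : ℕ) : Submodule ℂ (Std F W) :=
  eigSpace (Asub_plus F W φ) (q F ^ i / (q F - 1))

end Split

/-- A sequence `U_0, …, U_N` of nonzero subspaces whose sum is direct and equals the whole space. -/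
def IsDecomposition {M : Type*} [AddCommGroup M] [Module ℂ M] (N : ℕ)
    (U : ℕ → Submodule ℂ M) : Prop :=
  (∀ i ≤ N, U i ≠ ⊥) ∧ DirectSum.IsInternal fun i : Fin (N + 1) => U i

end ProjGeom

/-!
Put `K = (A*)⁻¹` and `M = K L`. A subspace of dimension `d` is covered by
`(q ^ (N - d) - 1) / (q - 1)` subspaces and covers `(q ^ d - 1) / (q - 1)` of them, and by modularity
two distinct subspaces have as many common covers as commonly covered subspaces. Hence `K`, `R`, `M`
satisfy `K R = q R K`, `M K = q K M` and `M R - q R M = (q ^ N - K ^ 2) / (q - 1)`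
(`isGraded_standard`). Put `X = K / (q - 1) - R` and `Y = K / (q - 1) + M`. The relations give
`q X Y - Y X = q ^ N / (q - 1)` (`IsGraded.qWeyl`). They survive the rescaling `R ↦ s⁻¹ R`, `M ↦ s M`,
and `(X, Y)` is `(A⁺, A⁻)` for `s = 1` and `(A₊, A₋)` for `s = -φ`. Moreover
`A = φ A⁻ - A⁺ = φ A₊ - A₋`.

Everything then rests on one fact about triangular operators (`iSup_Ici_eq_iSup_eigenspace`): if `T`
is triangular with respect to a decomposition, with distinct diagonal scalars, then the eigenspaces
of `T` induce the same flag as the decomposition. It is applied twice.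

* `X` and `Y` are bidiagonal on the eigenspaces of `K`, so `X` shares the upper flag
  `E*_i V + ⋯ + E*_N V` and `Y` shares the lower flag `E*_0 V + ⋯ + E*_i V`.
* By the `q`-Weyl relation, `X` is bidiagonal on the eigenspaces of `Y` and conversely, the diagonal
  scalar on the eigenspace for `q ^ i / (q - 1)` being `q ^ (N - i) / (q - 1)`. So `A` is bidiagonal
  on both, its diagonal scalars are the `θ_j` in one order or the other, and the `θ_j` are distinct
  because `φ > 0`.

Each eigenspace of `X` or `Y` is the intersection of the two opposite flags it generates, one of
which comes from the `E*_j V` and the other from the `E_j V`.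
-/

open Module End

namespace ProjGeom

/-! ### Triangular operators and flags of eigenspaces -/

section Triangular

variable {𝕜 V : Type*} [Field 𝕜] [AddCommGroup V] [Module 𝕜 V]
variable {ι : Type*} [LinearOrder ι]

theorem sub_smul_mem_iSup_Ioi {T : End 𝕜 V} {U : ι → Submodule 𝕜 V} {c : ι → 𝕜}
    (hT : ∀ i, ∀ v ∈ U i, T v - c i • v ∈ ⨆ (j) (_ : i < j), U j) (i : ι) {v : V}
    (hv : v ∈ ⨆ (j) (_ : i ≤ j), U j) : T v - c i • v ∈ ⨆ (j) (_ : i < j), U j := by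
  have key : (⨆ (j) (_ : i ≤ j), U j) ≤
      (⨆ (j) (_ : i < j), U j).comap (T - algebraMap 𝕜 (End 𝕜 V) (c i)) := by
    refine iSup₂_le fun k hk w hw => ?_
    rw [Submodule.mem_comap, LinearMap.sub_apply, Module.algebraMap_end_apply]
    rcases hk.eq_or_lt with rfl | hlt
    · exact hT _ w hw
    · have h₁ : T w - c k • w ∈ ⨆ (j) (_ : i < j), U j :=
        SetLike.le_def.1 (biSup_mono fun j hj => hlt.trans hj) (hT k w hw)
      have h₂ : w ∈ ⨆ (j) (_ : i < j), U j :=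
        le_iSup₂ (f := fun j (_ : i < j) => U j) k hlt hw
      have h₃ := add_mem h₁ (Submodule.smul_mem _ (c k - c i) h₂)
      rwa [sub_smul, sub_add_sub_cancel] at h₃
  exact key hv

/-- `T - c i` maps the sum of the eigenspaces of `T` for the scalars `c j`, `j > i`, onto itself. -/
theorem exists_sub_smul_eq_of_mem_iSup_eigenspace (T : End 𝕜 V) {c : ι → 𝕜}
    (hc : Function.Injective c) (i : ι) {w : V}
    (hw : w ∈ ⨆ (j) (_ : i < j), eigenspace T (c j)) :
    ∃ u ∈ ⨆ (j) (_ : i < j), eigenspace T (c j), T u - c i • u = w := by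
  have key : (⨆ (j) (_ : i < j), eigenspace T (c j)) ≤
      (⨆ (j) (_ : i < j), eigenspace T (c j)).map (T - algebraMap 𝕜 (End 𝕜 V) (c i)) := by
    refine iSup₂_le fun k hk w hw => ?_
    have hne : c k - c i ≠ 0 := sub_ne_zero.2 fun h => hk.ne' (hc h)
    refine ⟨(c k - c i)⁻¹ • w, Submodule.smul_mem _ _
      (le_iSup₂ (f := fun j (_ : i < j) => eigenspace T (c j)) k hk hw), ?_⟩
    rw [LinearMap.sub_apply, Module.algebraMap_end_apply, map_smul, mem_eigenspace_iff.1 hw,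
      smul_comm (c i), ← smul_sub, ← sub_smul, inv_smul_smul₀ hne]
  obtain ⟨u, hu, h⟩ := key hw
  exact ⟨u, hu, h⟩

/-- If `T` is triangular with respect to a spanning sequence `U`, with distinct diagonal scalars
`c i`, then the flag of `U` coincides with the flag of the eigenspaces of `T`. -/
theorem iSup_Ici_eq_iSup_eigenspace [Finite ι] [SuccOrder ι] [IsSuccArchimedean ι] [OrderBot ι]
    {T : End 𝕜 V} {U : ι → Submodule 𝕜 V} {c : ι → 𝕜}
    (hc : Function.Injective c) (hU : ⨆ i, U i = ⊤)
    (hT : ∀ i, ∀ v ∈ U i, T v - c i • v ∈ ⨆ (j) (_ : i < j), U j) (i : ι) :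
    ⨆ (j) (_ : i ≤ j), U j = ⨆ (j) (_ : i ≤ j), eigenspace T (c j) := by
  apply le_antisymm
  · have key : ∀ k, U k ≤ ⨆ (j) (_ : k ≤ j), eigenspace T (c j) := by
      intro k
      induction k using WellFoundedGT.induction with
      | ind k ih =>
        intro v hv
        -- correct `v` by a sum of higher eigenvectors so that the result is an eigenvector
        have h₁ : T v - c k • v ∈ ⨆ (j) (_ : k < j), eigenspace T (c j) :=
          iSup₂_le (fun j hj => (ih j hj).trans
            (biSup_mono fun l hl => lt_of_lt_of_le hj hl)) (hT k v hv)
        obtain ⟨u, hu, hu'⟩ := exists_sub_smul_eq_of_mem_iSup_eigenspace T hc k h₁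
        have h₂ : v - u ∈ eigenspace T (c k) := by
          rw [mem_eigenspace_iff, map_sub, smul_sub, sub_eq_sub_iff_sub_eq_sub, hu']
        have h₃ := add_mem
          (le_iSup₂ (f := fun j (_ : k ≤ j) => eigenspace T (c j)) k le_rfl h₂)
          (SetLike.le_def.1 (biSup_mono fun j (hj : k < j) => hj.le) hu)
        rwa [sub_add_cancel] at h₃
    exact iSup₂_le fun j hj => (key j).trans (biSup_mono fun l hl => hj.trans hl)
  · refine iSup₂_le fun k hk v hv => ?_
    have key : ∀ l, l ≤ k → v ∈ ⨆ (j) (_ : l ≤ j), U j := by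
      intro l
      induction l using Succ.rec_bot with
      | hbot => intro _; simp [hU]
      | hsucc l ih =>
        intro hl
        rcases (Order.le_succ l).eq_or_lt with h | h
        · rw [← h] at hl ⊢
          exact ih hl
        · have hlk := h.trans_le hl
          have h₁ := sub_smul_mem_iSup_Ioi hT l (ih hlk.le)
          rw [mem_eigenspace_iff.1 hv, ← sub_smul,
            Submodule.smul_mem_iff _ (sub_ne_zero.2 fun h => hlk.ne' (hc h))] at h₁
          exact SetLike.le_def.1 (biSup_mono fun j hj => Order.succ_le_of_lt hj) h₁
    exact SetLike.le_def.1 (biSup_mono fun j hj => hk.trans hj) (key k le_rfl)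

/-- If the eigenspace for `c i` were zero, two consecutive members of the flag would coincide. -/
theorem eigenspace_ne_bot_of_triangular [Finite ι] [SuccOrder ι] [IsSuccArchimedean ι]
    [OrderBot ι] {T : End 𝕜 V} {U : ι → Submodule 𝕜 V} {c : ι → 𝕜}
    (hc : Function.Injective c) (hU : ⨆ i, U i = ⊤)
    (hT : ∀ i, ∀ v ∈ U i, T v - c i • v ∈ ⨆ (j) (_ : i < j), U j)
    (hind : iSupIndep U) (i : ι) (hi : U i ≠ ⊥) : eigenspace T (c i) ≠ ⊥ := by
  have flag := iSup_Ici_eq_iSup_eigenspace hc hU hT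
  intro h
  apply hi
  have h₁ : U i ≤ ⨆ (j) (_ : j ≠ i), U j := by
    refine (le_iSup₂ (f := fun j (_ : i ≤ j) => U j) i le_rfl).trans ?_
    rw [flag i]
    refine iSup₂_le fun j hj => ?_
    rcases hj.eq_or_lt with rfl | hlt
    · simp [h]
    · refine (le_iSup₂ (f := fun k (_ : j ≤ k) => eigenspace T (c k)) j le_rfl).trans ?_
      rw [← flag j]
      exact biSup_mono fun k hk => (hlt.trans_le hk).ne'
  exact disjoint_self.1 ((hind i).mono_right h₁)

end Triangular

section Eigenspaces

variable {𝕜 V : Type*} [Field 𝕜] [AddCommGroup V] [Module 𝕜 V]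

theorem eigenspace_eq_bot_of_iSup_eq_top {ι : Type*} {T : End 𝕜 V} {c : ι → 𝕜}
    (h : ⨆ i, eigenspace T (c i) = ⊤) {μ : 𝕜} (hμ : ∀ i, c i ≠ μ) : eigenspace T μ = ⊥ := by
  refine disjoint_self.1 ((T.eigenspaces_iSupIndep μ).mono_right ?_)
  refine le_top.trans (h.symm.le.trans (iSup_le fun i => ?_))
  exact le_iSup₂ (f := fun ν (_ : ν ≠ μ) => eigenspace T ν) (c i) (hμ i)

theorem iSupIndep_eigenspace_comp {ι : Type*} (T : End 𝕜 V) {c : ι → 𝕜}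
    (hc : Function.Injective c) : iSupIndep fun i => eigenspace T (c i) :=
  T.eigenspaces_iSupIndep.comp hc

/-- In an independent family, the partial sums up to `i` and from `i` on meet in the `i`-th term. -/
theorem iSup_Iic_inf_iSup_Ici {ι : Type*} [LinearOrder ι] {U : ι → Submodule 𝕜 V}
    (hU : iSupIndep U) (i : ι) :
    (⨆ (j) (_ : j ≤ i), U j) ⊓ (⨆ (j) (_ : i ≤ j), U j) = U i := by
  apply le_antisymm
  · have h₁ : (⨆ (j) (_ : j ≤ i), U j) ≤ U i ⊔ ⨆ (j) (_ : j < i), U j := by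
      refine iSup₂_le fun j hj => ?_
      rcases hj.eq_or_lt with rfl | hlt
      · exact le_sup_left
      · exact le_sup_of_le_right (le_iSup₂ (f := fun j (_ : j < i) => U j) j hlt)
    have h₂ : U i ≤ ⨆ (j) (_ : i ≤ j), U j :=
      le_iSup₂ (f := fun j (_ : i ≤ j) => U j) i le_rfl
    have h₃ : Disjoint (⨆ (j) (_ : j < i), U j) (⨆ (j) (_ : i ≤ j), U j) := by
      have := hU.disjoint_biSup_biSup (s := Set.Iio i) (t := Set.Ici i)
        (Set.disjoint_left.2 fun j hj hj' => (not_le_of_gt hj) hj')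
      simpa using this
    calc _ ≤ (U i ⊔ ⨆ (j) (_ : j < i), U j) ⊓ (⨆ (j) (_ : i ≤ j), U j) := inf_le_inf_right _ h₁
      _ ≤ U i ⊔ (⨆ (j) (_ : j < i), U j) ⊓ (⨆ (j) (_ : i ≤ j), U j) :=
        (sup_inf_assoc_of_le _ h₂).le
      _ = U i := by rw [h₃.eq_bot, sup_bot_eq]
  · exact le_inf (le_iSup₂ (f := fun j (_ : j ≤ i) => U j) i le_rfl)
      (le_iSup₂ (f := fun j (_ : i ≤ j) => U j) i le_rfl)

end Eigenspaces

/-! ### Bidiagonal operators and the `q`-Weyl relation -/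

section Bidiagonal

variable {𝕜 V : Type*} [Field 𝕜] [AddCommGroup V] [Module 𝕜 V]
variable {N : ℕ} {q a : 𝕜} {S T : End 𝕜 V} {c : Fin (N + 1) → 𝕜}

theorem geometric_injective (hq : Function.Injective fun n : ℕ => q ^ n) (ha : a ≠ 0) :
    Function.Injective fun i : Fin (N + 1) => a * q ^ (i : ℕ) :=
  fun _ _ h => Fin.ext (hq (mul_left_cancel₀ ha h))

theorem sub_smul_mem_iSup_Ioi_of_raising (hq : Function.Injective fun n : ℕ => q ^ n) (ha : a ≠ 0)
    (hS : ⨆ i : Fin (N + 1), eigenspace S (a * q ^ (i : ℕ)) = ⊤)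
    (hT : ∀ i : Fin (N + 1), ∀ v ∈ eigenspace S (a * q ^ (i : ℕ)),
      T v - c i • v ∈ eigenspace S (q * (a * q ^ (i : ℕ)))) (i : Fin (N + 1)) (v : V)
    (hv : v ∈ eigenspace S (a * q ^ (i : ℕ))) :
    T v - c i • v ∈ ⨆ (j : Fin (N + 1)) (_ : i < j), eigenspace S (a * q ^ (j : ℕ)) := by
  have h := hT i v hv
  rw [mul_left_comm, ← pow_succ'] at h
  by_cases hi : (i : ℕ) + 1 < N + 1
  · exact le_iSup₂ (f := fun (j : Fin (N + 1)) (_ : i < j) => eigenspace S (a * q ^ (j : ℕ)))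
      ⟨i + 1, hi⟩ (Fin.lt_def.2 (Nat.lt_succ_self _)) h
  -- for `i = N` the next term of the progression is not an eigenvalue of `S`
  · rw [eigenspace_eq_bot_of_iSup_eq_top hS, Submodule.mem_bot] at h
    · rw [h]
      exact zero_mem _
    · intro j hj
      have := hq (mul_left_cancel₀ ha hj)
      omega

theorem sub_smul_mem_iSup_Iio_of_lowering (hq0 : q ≠ 0)
    (hq : Function.Injective fun n : ℕ => q ^ n) (ha : a ≠ 0)
    (hS : ⨆ i : Fin (N + 1), eigenspace S (a * q ^ (i : ℕ)) = ⊤)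
    (hT : ∀ i : Fin (N + 1), ∀ v ∈ eigenspace S (a * q ^ (i : ℕ)),
      T v - c i • v ∈ eigenspace S (q⁻¹ * (a * q ^ (i : ℕ)))) (i : Fin (N + 1)) (v : V)
    (hv : v ∈ eigenspace S (a * q ^ (i : ℕ))) :
    T v - c i • v ∈ ⨆ (j : Fin (N + 1)) (_ : j < i), eigenspace S (a * q ^ (j : ℕ)) := by
  have h := hT i v hv
  rw [mul_left_comm] at h
  rcases Nat.eq_zero_or_pos (i : ℕ) with hi | hi
  · rw [eigenspace_eq_bot_of_iSup_eq_top hS, Submodule.mem_bot] at h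
    · rw [h]
      exact zero_mem _
    · intro j hj
      have h₁ := mul_left_cancel₀ ha hj
      rw [hi, eq_inv_mul_iff_mul_eq₀ hq0, ← pow_succ'] at h₁
      have := hq h₁
      omega
  · obtain ⟨k, hk⟩ := Nat.exists_eq_succ_of_ne_zero hi.ne'
    rw [hk, Nat.succ_eq_add_one, pow_succ', inv_mul_cancel_left₀ hq0] at h
    exact le_iSup₂ (f := fun (j : Fin (N + 1)) (_ : j < i) => eigenspace S (a * q ^ (j : ℕ)))
      ⟨k, by omega⟩ (Fin.lt_def.2 (by simp [hk])) h

/-- If `T - c i` raises the eigenspaces of `S`, whose eigenvalues form a geometric progression, then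
the upper flags of `S` and `T` coincide. -/
theorem iSup_Ici_eigenspace_eq_of_raising (hq : Function.Injective fun n : ℕ => q ^ n) (ha : a ≠ 0)
    (hc : Function.Injective c)
    (hS : ⨆ i : Fin (N + 1), eigenspace S (a * q ^ (i : ℕ)) = ⊤)
    (hT : ∀ i : Fin (N + 1), ∀ v ∈ eigenspace S (a * q ^ (i : ℕ)),
      T v - c i • v ∈ eigenspace S (q * (a * q ^ (i : ℕ)))) (i : Fin (N + 1)) :
    ⨆ (j : Fin (N + 1)) (_ : i ≤ j), eigenspace S (a * q ^ (j : ℕ)) =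
      ⨆ (j : Fin (N + 1)) (_ : i ≤ j), eigenspace T (c j) :=
  iSup_Ici_eq_iSup_eigenspace hc hS (sub_smul_mem_iSup_Ioi_of_raising hq ha hS hT) i

theorem eigenspace_ne_bot_of_raising (hq : Function.Injective fun n : ℕ => q ^ n) (ha : a ≠ 0)
    (hc : Function.Injective c)
    (hS : ⨆ i : Fin (N + 1), eigenspace S (a * q ^ (i : ℕ)) = ⊤)
    (hT : ∀ i : Fin (N + 1), ∀ v ∈ eigenspace S (a * q ^ (i : ℕ)),
      T v - c i • v ∈ eigenspace S (q * (a * q ^ (i : ℕ)))) (i : Fin (N + 1))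
    (hi : eigenspace S (a * q ^ (i : ℕ)) ≠ ⊥) : eigenspace T (c i) ≠ ⊥ :=
  eigenspace_ne_bot_of_triangular hc hS (sub_smul_mem_iSup_Ioi_of_raising hq ha hS hT)
    (iSupIndep_eigenspace_comp S (geometric_injective hq ha)) i hi

/-- If `T - c i` lowers the eigenspaces of `S`, whose eigenvalues form a geometric progression, then
the lower flags of `S` and `T` coincide. -/
theorem iSup_Iic_eigenspace_eq_of_lowering (hq0 : q ≠ 0)
    (hq : Function.Injective fun n : ℕ => q ^ n) (ha : a ≠ 0) (hc : Function.Injective c)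
    (hS : ⨆ i : Fin (N + 1), eigenspace S (a * q ^ (i : ℕ)) = ⊤)
    (hT : ∀ i : Fin (N + 1), ∀ v ∈ eigenspace S (a * q ^ (i : ℕ)),
      T v - c i • v ∈ eigenspace S (q⁻¹ * (a * q ^ (i : ℕ)))) (i : Fin (N + 1)) :
    ⨆ (j : Fin (N + 1)) (_ : j ≤ i), eigenspace S (a * q ^ (j : ℕ)) =
      ⨆ (j : Fin (N + 1)) (_ : j ≤ i), eigenspace T (c j) :=
  iSup_Ici_eq_iSup_eigenspace (ι := (Fin (N + 1))ᵒᵈ)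
    (U := fun j => eigenspace S (a * q ^ ((OrderDual.ofDual j : Fin (N + 1)) : ℕ)))
    (c := fun j => c (OrderDual.ofDual j)) hc hS
    (sub_smul_mem_iSup_Iio_of_lowering hq0 hq ha hS hT) (OrderDual.toDual i)

theorem eigenspace_ne_bot_of_lowering (hq0 : q ≠ 0)
    (hq : Function.Injective fun n : ℕ => q ^ n) (ha : a ≠ 0) (hc : Function.Injective c)
    (hS : ⨆ i : Fin (N + 1), eigenspace S (a * q ^ (i : ℕ)) = ⊤)
    (hT : ∀ i : Fin (N + 1), ∀ v ∈ eigenspace S (a * q ^ (i : ℕ)),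
      T v - c i • v ∈ eigenspace S (q⁻¹ * (a * q ^ (i : ℕ)))) (i : Fin (N + 1))
    (hi : eigenspace S (a * q ^ (i : ℕ)) ≠ ⊥) : eigenspace T (c i) ≠ ⊥ :=
  eigenspace_ne_bot_of_triangular (ι := (Fin (N + 1))ᵒᵈ)
    (U := fun j => eigenspace S (a * q ^ ((OrderDual.ofDual j : Fin (N + 1)) : ℕ)))
    (c := fun j => c (OrderDual.ofDual j)) hc hS
    (sub_smul_mem_iSup_Iio_of_lowering hq0 hq ha hS hT)
    (iSupIndep_eigenspace_comp S (geometric_injective hq ha)) (OrderDual.toDual i) hi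

end Bidiagonal

section QWeyl

variable {𝕜 V : Type*} [Field 𝕜] [AddCommGroup V] [Module 𝕜 V]
variable {q a c : 𝕜} {X Y : End 𝕜 V} {v : V}

/-- If `q X Y - Y X` is a scalar, then `X` acts on an eigenspace of `Y` as a scalar plus a map into
the eigenspace whose eigenvalue is `q` times larger. -/
theorem qWeyl_raising (h : q • (X * Y) - Y * X = c • 1) (hq : q - 1 ≠ 0) (ha : a ≠ 0)
    (hv : v ∈ eigenspace Y a) :
    X v - (c / ((q - 1) * a)) • v ∈ eigenspace Y (q * a) := by
  rw [mem_eigenspace_iff] at hv ⊢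
  have h₁ := LinearMap.congr_fun h v
  simp only [LinearMap.sub_apply, LinearMap.smul_apply, End.mul_apply, End.one_apply, hv,
    map_smul] at h₁
  have h₂ : c = c / ((q - 1) * a) * ((q - 1) * a) := by field_simp
  rw [h₂] at h₁
  simp only [map_sub, map_smul, hv]
  generalize c / ((q - 1) * a) = d at *
  linear_combination (norm := module) -h₁

theorem qWeyl_lowering (h : q • (X * Y) - Y * X = c • 1) (hq0 : q ≠ 0) (hq : q - 1 ≠ 0)
    (ha : a ≠ 0) (hv : v ∈ eigenspace X a) :
    Y v - (c / ((q - 1) * a)) • v ∈ eigenspace X (q⁻¹ * a) := by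
  rw [mem_eigenspace_iff] at hv ⊢
  have h₁ := LinearMap.congr_fun h v
  simp only [LinearMap.sub_apply, LinearMap.smul_apply, End.mul_apply, End.one_apply, hv,
    map_smul] at h₁
  have h₂ : c = c / ((q - 1) * a) * ((q - 1) * a) := by field_simp
  rw [h₂] at h₁
  simp only [map_sub, map_smul, hv]
  generalize c / ((q - 1) * a) = d at *
  rw [mul_smul, eq_inv_smul_iff₀ hq0]
  linear_combination (norm := module) h₁

end QWeyl

/-! ### Split decompositions attached to graded raising and lowering maps -/

section SplitDecompositions

variable {𝕜 V : Type*} [Field 𝕜] [AddCommGroup V] [Module 𝕜 V]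

/-- The relations satisfied by `K = (A*)⁻¹`, `R` and `M = (A*)⁻¹ L`: `q` is not a root of unity, the
eigenspaces of `K` for `1, q, …, q ^ N` are nonzero and span, `R` raises them, `M` lowers them, and
`M R - q R M` is the indicated polynomial in `K`. The eigenvalues are written `1 * q ^ i` to match
the geometric progressions `a * q ^ i` of the bidiagonal lemmas. -/
structure IsGraded (q : 𝕜) (N : ℕ) (K R M : End 𝕜 V) : Prop where
  ne_zero : q ≠ 0
  pow_injective : Function.Injective fun n : ℕ => q ^ n
  raising : K * R = q • (R * K)
  lowering : M * K = q • (K * M)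
  comm : M * R - q • (R * M) = (q - 1)⁻¹ • (q ^ N • 1 - K * K)
  iSup_eq_top : ⨆ i : Fin (N + 1), eigenspace K (1 * q ^ (i : ℕ)) = ⊤
  ne_bot : ∀ i : Fin (N + 1), eigenspace K (1 * q ^ (i : ℕ)) ≠ ⊥

namespace IsGraded

variable {q : 𝕜} {N : ℕ} {K R M : End 𝕜 V}

/-- The relations are homogeneous: scaling `R` and `M` by inverse scalars preserves them. -/
theorem rescale (h : IsGraded q N K R M) {s : 𝕜} (hs : s ≠ 0) :
    IsGraded q N K (s⁻¹ • R) (s • M) where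
  ne_zero := h.ne_zero
  pow_injective := h.pow_injective
  raising := by
    rw [mul_smul_comm, smul_mul_assoc, h.raising, smul_comm]
  lowering := by
    rw [mul_smul_comm, smul_mul_assoc, h.lowering, smul_comm]
  comm := by
    rw [smul_mul_smul_comm, smul_mul_smul_comm, mul_inv_cancel₀ hs, inv_mul_cancel₀ hs, one_smul,
      one_smul, h.comm]
  iSup_eq_top := h.iSup_eq_top
  ne_bot := h.ne_bot

theorem sub_one_ne_zero (h : IsGraded q N K R M) : q - 1 ≠ 0 := by
  intro h₁
  have := @h.pow_injective 0 1 (by simp [sub_eq_zero.1 h₁])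
  omega

/-- The pair `K / (q - 1) - R`, `K / (q - 1) + M` satisfies a `q`-Weyl relation. -/
theorem qWeyl (h : IsGraded q N K R M) :
    q • (((q - 1)⁻¹ • K - R) * ((q - 1)⁻¹ • K + M)) -
      ((q - 1)⁻¹ • K + M) * ((q - 1)⁻¹ • K - R) = (q ^ N / (q - 1)) • 1 := by
  have h₁ := congrArg (· • (K * K))
    (mul_inv_cancel_left₀ h.sub_one_ne_zero (q - 1)⁻¹)
  have h₂ := h.raising
  have h₃ := h.lowering
  have h₄ := h.comm
  rw [div_eq_mul_inv]
  simp only [mul_add, add_mul, mul_sub, sub_mul, smul_mul_assoc, mul_smul_comm] at h₁ ⊢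
  generalize (q - 1)⁻¹ = k at *
  linear_combination (norm := module) h₁ + k • h₂ - k • h₃ + h₄

/-- The scalar appearing in `qWeyl_raising` and `qWeyl_lowering` for the eigenvalue
`q ^ i / (q - 1)` is `q ^ (N - i) / (q - 1)`. -/
theorem scalar_eq (h : IsGraded q N K R M) (i : Fin (N + 1)) :
    q ^ N / (q - 1) / ((q - 1) * ((q - 1)⁻¹ * q ^ (i : ℕ))) = q ^ (N - (i : ℕ)) / (q - 1) := by
  rw [mul_inv_cancel_left₀ h.sub_one_ne_zero, div_right_comm,
    pow_sub₀ _ h.ne_zero (Nat.lt_succ_iff.1 i.2), ← div_eq_mul_inv]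

section

variable (h : IsGraded q N K R M) (i : Fin (N + 1))
include h

theorem inv_sub_one_ne_zero : (q - 1)⁻¹ ≠ 0 := inv_ne_zero h.sub_one_ne_zero

theorem upper_mapsTo {v : V} (hv : v ∈ eigenspace K (1 * q ^ (i : ℕ))) :
    ((q - 1)⁻¹ • K - R) v - ((q - 1)⁻¹ * q ^ (i : ℕ)) • v ∈
      eigenspace K (q * (1 * q ^ (i : ℕ))) := by
  rw [one_mul, mem_eigenspace_iff] at hv ⊢
  have h₁ := LinearMap.congr_fun h.raising v
  simp only [LinearMap.smul_apply, End.mul_apply, hv, map_smul] at h₁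
  simp only [LinearMap.sub_apply, LinearMap.smul_apply, map_sub, map_smul, hv, h₁]
  module

theorem lower_mapsTo {v : V} (hv : v ∈ eigenspace K (1 * q ^ (i : ℕ))) :
    ((q - 1)⁻¹ • K + M) v - ((q - 1)⁻¹ * q ^ (i : ℕ)) • v ∈
      eigenspace K (q⁻¹ * (1 * q ^ (i : ℕ))) := by
  rw [one_mul, mem_eigenspace_iff] at hv ⊢
  have h₁ := LinearMap.congr_fun h.lowering v
  simp only [LinearMap.smul_apply, End.mul_apply, hv, map_smul] at h₁
  rw [mul_smul q⁻¹, eq_inv_smul_iff₀ h.ne_zero]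
  simp only [LinearMap.add_apply, LinearMap.smul_apply, map_add, map_sub, map_smul, hv]
  linear_combination (norm := module) -h₁

theorem upper_flag :
    ⨆ (j : Fin (N + 1)) (_ : i ≤ j), eigenspace K (1 * q ^ (j : ℕ)) =
      ⨆ (j : Fin (N + 1)) (_ : i ≤ j),
        eigenspace ((q - 1)⁻¹ • K - R) ((q - 1)⁻¹ * q ^ (j : ℕ)) :=
  iSup_Ici_eigenspace_eq_of_raising h.pow_injective one_ne_zero
    (geometric_injective h.pow_injective h.inv_sub_one_ne_zero) h.iSup_eq_top
    (fun i _ hv => h.upper_mapsTo i hv) i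

theorem lower_flag :
    ⨆ (j : Fin (N + 1)) (_ : j ≤ i), eigenspace K (1 * q ^ (j : ℕ)) =
      ⨆ (j : Fin (N + 1)) (_ : j ≤ i),
        eigenspace ((q - 1)⁻¹ • K + M) ((q - 1)⁻¹ * q ^ (j : ℕ)) :=
  iSup_Iic_eigenspace_eq_of_lowering h.ne_zero h.pow_injective one_ne_zero
    (geometric_injective h.pow_injective h.inv_sub_one_ne_zero) h.iSup_eq_top
    (fun i _ hv => h.lower_mapsTo i hv) i

theorem upper_ne_bot :
    eigenspace ((q - 1)⁻¹ • K - R) ((q - 1)⁻¹ * q ^ (i : ℕ)) ≠ ⊥ :=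
  eigenspace_ne_bot_of_raising h.pow_injective one_ne_zero
    (geometric_injective h.pow_injective h.inv_sub_one_ne_zero) h.iSup_eq_top
    (fun i _ hv => h.upper_mapsTo i hv) i (h.ne_bot i)

theorem lower_ne_bot :
    eigenspace ((q - 1)⁻¹ • K + M) ((q - 1)⁻¹ * q ^ (i : ℕ)) ≠ ⊥ :=
  eigenspace_ne_bot_of_lowering h.ne_zero h.pow_injective one_ne_zero
    (geometric_injective h.pow_injective h.inv_sub_one_ne_zero) h.iSup_eq_top
    (fun i _ hv => h.lower_mapsTo i hv) i (h.ne_bot i)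

theorem upper_iSup_eq_top :
    ⨆ j : Fin (N + 1), eigenspace ((q - 1)⁻¹ • K - R) ((q - 1)⁻¹ * q ^ (j : ℕ)) = ⊤ := by
  have := h.upper_flag 0
  simp only [Fin.zero_le, iSup_pos] at this
  rw [← this, h.iSup_eq_top]

theorem lower_iSup_eq_top :
    ⨆ j : Fin (N + 1), eigenspace ((q - 1)⁻¹ • K + M) ((q - 1)⁻¹ * q ^ (j : ℕ)) = ⊤ := by
  have := h.lower_flag (Fin.last N)
  simp only [Fin.le_last, iSup_pos] at this
  rw [← this, h.iSup_eq_top]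

theorem geometric_ne_zero : (q - 1)⁻¹ * q ^ (i : ℕ) ≠ 0 :=
  mul_ne_zero h.inv_sub_one_ne_zero (pow_ne_zero _ h.ne_zero)

variable {α β : 𝕜} {ν : Fin (N + 1) → 𝕜}

theorem combination_raising
    (hν : ∀ j : Fin (N + 1), ν j = (α * q ^ (j : ℕ) + β * q ^ (N - (j : ℕ))) / (q - 1)) {v : V}
    (hv : v ∈ eigenspace ((q - 1)⁻¹ • K + M) ((q - 1)⁻¹ * q ^ (i : ℕ))) :
    (α • ((q - 1)⁻¹ • K + M) + β • ((q - 1)⁻¹ • K - R)) v - ν i • v ∈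
      eigenspace ((q - 1)⁻¹ • K + M) (q * ((q - 1)⁻¹ * q ^ (i : ℕ))) := by
  have h₁ := Submodule.smul_mem _ β
    (qWeyl_raising h.qWeyl h.sub_one_ne_zero (h.geometric_ne_zero i) hv)
  rw [h.scalar_eq] at h₁
  convert h₁ using 1
  rw [LinearMap.add_apply, LinearMap.smul_apply, mem_eigenspace_iff.1 hv, hν,
    LinearMap.smul_apply, div_eq_mul_inv, div_eq_mul_inv]
  module

theorem combination_lowering
    (hν : ∀ j : Fin (N + 1), ν j = (α * q ^ (j : ℕ) + β * q ^ (N - (j : ℕ))) / (q - 1)) {v : V}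
    (hv : v ∈ eigenspace ((q - 1)⁻¹ • K - R) ((q - 1)⁻¹ * q ^ (i : ℕ))) :
    (α • ((q - 1)⁻¹ • K + M) + β • ((q - 1)⁻¹ • K - R)) v - ν i.rev • v ∈
      eigenspace ((q - 1)⁻¹ • K - R) (q⁻¹ * ((q - 1)⁻¹ * q ^ (i : ℕ))) := by
  have h₁ := Submodule.smul_mem _ α
    (qWeyl_lowering h.qWeyl h.ne_zero h.sub_one_ne_zero (h.geometric_ne_zero i) hv)
  rw [h.scalar_eq] at h₁
  convert h₁ using 1
  have h₂ : (i.rev : ℕ) = N - i := by rw [Fin.val_rev]; omega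
  have h₃ : N - (N - (i : ℕ)) = i := by omega
  rw [LinearMap.add_apply, LinearMap.smul_apply, LinearMap.smul_apply, mem_eigenspace_iff.1 hv,
    hν, h₂, h₃, div_eq_mul_inv, div_eq_mul_inv]
  module

/-- The upper flag of `K / (q - 1) + M` is a flag of eigenspaces of any combination of
`K / (q - 1) + M` and `K / (q - 1) - R` with distinct scalars `ν j`. -/
theorem combination_upper_flag (hinj : Function.Injective ν)
    (hν : ∀ j : Fin (N + 1), ν j = (α * q ^ (j : ℕ) + β * q ^ (N - (j : ℕ))) / (q - 1)) :
    ⨆ (j : Fin (N + 1)) (_ : i ≤ j),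
        eigenspace ((q - 1)⁻¹ • K + M) ((q - 1)⁻¹ * q ^ (j : ℕ)) =
      ⨆ (j : Fin (N + 1)) (_ : i ≤ j),
        eigenspace (α • ((q - 1)⁻¹ • K + M) + β • ((q - 1)⁻¹ • K - R)) (ν j) :=
  iSup_Ici_eigenspace_eq_of_raising h.pow_injective h.inv_sub_one_ne_zero hinj h.lower_iSup_eq_top
    (fun i _ hv => h.combination_raising i hν hv) i

/-- The lower flag of `K / (q - 1) - R` is a flag of eigenspaces of the same combination, with the
scalars in reverse order. -/
theorem combination_lower_flag (hinj : Function.Injective ν)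
    (hν : ∀ j : Fin (N + 1), ν j = (α * q ^ (j : ℕ) + β * q ^ (N - (j : ℕ))) / (q - 1)) :
    ⨆ (j : Fin (N + 1)) (_ : j ≤ i),
        eigenspace ((q - 1)⁻¹ • K - R) ((q - 1)⁻¹ * q ^ (j : ℕ)) =
      ⨆ (j : Fin (N + 1)) (_ : j ≤ i),
        eigenspace (α • ((q - 1)⁻¹ • K + M) + β • ((q - 1)⁻¹ • K - R)) (ν j.rev) :=
  iSup_Iic_eigenspace_eq_of_lowering h.ne_zero h.pow_injective h.inv_sub_one_ne_zero
    (hinj.comp Fin.rev_injective) h.upper_iSup_eq_top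
    (fun i _ hv => h.combination_lowering i hν hv) i

theorem combination_ne_bot (hinj : Function.Injective ν)
    (hν : ∀ j : Fin (N + 1), ν j = (α * q ^ (j : ℕ) + β * q ^ (N - (j : ℕ))) / (q - 1)) :
    eigenspace (α • ((q - 1)⁻¹ • K + M) + β • ((q - 1)⁻¹ • K - R)) (ν i) ≠ ⊥ :=
  eigenspace_ne_bot_of_raising h.pow_injective h.inv_sub_one_ne_zero hinj h.lower_iSup_eq_top
    (fun i _ hv => h.combination_raising i hν hv) i (h.lower_ne_bot i)

theorem lower_eigenspace_eq_inf (hinj : Function.Injective ν)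
    (hν : ∀ j : Fin (N + 1), ν j = (α * q ^ (j : ℕ) + β * q ^ (N - (j : ℕ))) / (q - 1)) :
    eigenspace ((q - 1)⁻¹ • K + M) ((q - 1)⁻¹ * q ^ (i : ℕ)) =
      (⨆ (j : Fin (N + 1)) (_ : j ≤ i), eigenspace K (1 * q ^ (j : ℕ))) ⊓
      ⨆ (j : Fin (N + 1)) (_ : i ≤ j),
        eigenspace (α • ((q - 1)⁻¹ • K + M) + β • ((q - 1)⁻¹ • K - R)) (ν j) := by
  rw [h.lower_flag, ← h.combination_upper_flag i hinj hν]
  exact (iSup_Iic_inf_iSup_Ici (iSupIndep_eigenspace_comp _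
    (geometric_injective h.pow_injective h.inv_sub_one_ne_zero)) i).symm

theorem upper_eigenspace_eq_inf (hinj : Function.Injective ν)
    (hν : ∀ j : Fin (N + 1), ν j = (α * q ^ (j : ℕ) + β * q ^ (N - (j : ℕ))) / (q - 1)) :
    eigenspace ((q - 1)⁻¹ • K - R) ((q - 1)⁻¹ * q ^ (i : ℕ)) =
      (⨆ (j : Fin (N + 1)) (_ : i ≤ j), eigenspace K (1 * q ^ (j : ℕ))) ⊓
      ⨆ (j : Fin (N + 1)) (_ : j ≤ i),
        eigenspace (α • ((q - 1)⁻¹ • K + M) + β • ((q - 1)⁻¹ • K - R)) (ν j.rev) := by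
  rw [h.upper_flag, ← h.combination_lower_flag i hinj hν, inf_comm]
  exact (iSup_Iic_inf_iSup_Ici (iSupIndep_eigenspace_comp _
    (geometric_injective h.pow_injective h.inv_sub_one_ne_zero)) i).symm

theorem combination_iSup_eq_top (hinj : Function.Injective ν)
    (hν : ∀ j : Fin (N + 1), ν j = (α * q ^ (j : ℕ) + β * q ^ (N - (j : ℕ))) / (q - 1)) :
    ⨆ j : Fin (N + 1),
      eigenspace (α • ((q - 1)⁻¹ • K + M) + β • ((q - 1)⁻¹ • K - R)) (ν j) = ⊤ := by
  have := h.combination_upper_flag 0 hinj hν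
  simp only [Fin.zero_le, iSup_pos] at this
  rw [← this, h.lower_iSup_eq_top]

end

end IsGraded

end SplitDecompositions

/-! ### Subspaces covering a subspace, and the relations between `A*`, `R` and `L` -/

section Covers

variable {F W : Type*} [Field F] [AddCommGroup W] [Module F W] [FiniteDimensional F W]

theorem finrank_eq_add_one_of_covBy {y z : Submodule F W} (h : y ⋖ z) :
    finrank F z = finrank F y + 1 := by
  have h₁ := isSimpleModule_iff_finrank_eq_one.1 ((covBy_iff_quot_is_simple h.le).1 h)
  have h₂ := Submodule.finrank_quotient_add_finrank (y.comap z.subtype)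
  rw [(Submodule.comapSubtypeEquivOfLe h.le).finrank_eq, h₁] at h₂
  omega

theorem exists_submodule_finrank_eq {i : ℕ} (hi : i ≤ finrank F W) :
    ∃ y : Submodule F W, finrank F y = i := by
  refine ⟨Submodule.span F (Set.range fun j : Fin i => finBasis F W (Fin.castLE hi j)), ?_⟩
  rw [finrank_span_eq_card]
  · simp
  · exact (finBasis F W).linearIndependent.comp _ (Fin.castLE_injective hi)

variable (F W) in
/-- The atoms of the subspace lattice are the points of the projective space. -/
theorem card_atoms [Finite F] :
    (Nat.card {S : Submodule F W // IsAtom S} : ℂ) * (q F - 1) = q F ^ finrank F W - 1 := by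
  have : Finite W := Module.finite_of_finite F
  simp_rw [Submodule.isAtom_iff_finrank_eq_one]
  rw [← Nat.card_congr (Projectivization.equivSubmodule F W)]
  have h := Projectivization.card' F W
  have hF : 1 ≤ Nat.card F := Finite.one_lt_card.le
  rw [Module.natCard_eq_pow_finrank (K := F)] at h
  have h' := congrArg (Nat.cast : ℕ → ℂ) h
  push_cast [hF] at h'
  rw [q, h', add_sub_cancel_right]

/-- The subspaces covering `y` are the atoms of the quotient by `y`. -/
theorem card_covering [Finite F] (y : Submodule F W) :
    (Nat.card {z : Submodule F W // y ⋖ z} : ℂ) * (q F - 1) =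
      q F ^ (finrank F W - finrank F y) - 1 := by
  have e : {S : Submodule F (W ⧸ y) // IsAtom S} ≃ {z : Submodule F W // y ⋖ z} :=
    (Equiv.subtypeEquiv (q := fun b : Set.Ici y => y ⋖ (b : Submodule F W))
      (Submodule.comapMkQRelIso y).toEquiv fun S => by
        rw [covBy_iff_atom_Ici (Submodule.comapMkQRelIso y S).2]
        exact ((Submodule.comapMkQRelIso y).isAtom_iff S).symm).trans
    (Equiv.subtypeSubtypeEquivSubtype (p := (· ∈ Set.Ici y)) fun {_} h => CovBy.le h)
  rw [← Nat.card_congr e, card_atoms, Submodule.finrank_quotient]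

/-- The subspaces covered by `y` are the hyperplanes of `y`, that is, the atoms of the dual. -/
theorem card_covered [Finite F] (y : Submodule F W) :
    (Nat.card {z : Submodule F W // z ⋖ y} : ℂ) * (q F - 1) = q F ^ finrank F y - 1 := by
  have e : Submodule F y ≃o (Submodule F (Dual F y))ᵒᵈ := Subspace.orderIsoFiniteDimensional
  have e₁ : {S : Submodule F (Dual F y) // IsAtom S} ≃ {S : Submodule F y // IsCoatom S} :=
    (Equiv.subtypeEquiv (e.toEquiv.trans OrderDual.ofDual) fun S =>
      (e.isCoatom_iff S).symm.trans
        (isCoatom_dual_iff_isAtom (a := OrderDual.ofDual (e S)))).symm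
  have e₂ : {S : Submodule F y // IsCoatom S} ≃ {z : Submodule F W // z ⋖ y} :=
    (Equiv.subtypeEquiv (q := fun b : Set.Iic y => (b : Submodule F W) ⋖ y)
      (Submodule.mapIic y).toEquiv fun S => by
        rw [covBy_iff_coatom_Iic (Submodule.mapIic y S).2]
        exact ((Submodule.mapIic y).isCoatom_iff S).symm).trans
    (Equiv.subtypeSubtypeEquivSubtype (p := (· ∈ Set.Iic y)) (q := (· ⋖ y)) fun {_} h =>
      CovBy.le h)
  rw [← Nat.card_congr e₂, ← Nat.card_congr e₁, card_atoms, Subspace.dual_finrank_eq]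

end Covers

section Matrices

variable (F W : Type*) [Field F] [Finite F] [AddCommGroup W] [Module F W] [FiniteDimensional F W]

theorem q_pow_injective : Function.Injective fun n : ℕ => q F ^ n := by
  intro m n h
  have h' : Nat.card F ^ m = Nat.card F ^ n := by
    simp only [q] at h
    exact_mod_cast h
  exact Nat.pow_right_injective Finite.one_lt_card h'

theorem q_ne_zero : q F ≠ 0 := by
  rw [q, Nat.cast_ne_zero]
  exact Nat.card_pos.ne'

theorem q_sub_one_ne_zero : q F - 1 ≠ 0 := by
  rw [q, sub_ne_zero, Nat.cast_ne_one]
  exact Finite.one_lt_card.ne'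

open Classical in
theorem Astar_inv : (Astar F W)⁻¹ = Matrix.diagonal fun y : Submodule F W => q F ^ finrank F y := by
  apply Matrix.inv_eq_right_inv
  rw [Astar, Matrix.diagonal_mul_diagonal, ← Matrix.diagonal_one]
  congr 1
  ext y
  exact inv_mul_cancel₀ (pow_ne_zero _ (q_ne_zero F))

open Classical in
theorem Astar_inv_mul_R : (Astar F W)⁻¹ * R F W = q F • (R F W * (Astar F W)⁻¹) := by
  ext y z
  rw [Astar_inv, Matrix.diagonal_mul, Matrix.smul_apply, Matrix.mul_diagonal, R, Matrix.of_apply,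
    smul_eq_mul]
  split_ifs with h
  · rw [finrank_eq_add_one_of_covBy h, pow_succ']
    ring
  · simp

open Classical in
theorem L_mul_Astar_inv : L F W * (Astar F W)⁻¹ = q F • ((Astar F W)⁻¹ * L F W) := by
  ext y z
  rw [Astar_inv, Matrix.mul_diagonal, Matrix.smul_apply, Matrix.diagonal_mul, L, Matrix.of_apply,
    smul_eq_mul]
  split_ifs with h
  · rw [finrank_eq_add_one_of_covBy h, pow_succ']
    ring
  · simp

variable {F W}

theorem L_mul_R_apply_self (y : Submodule F W) :
    (L F W * R F W) y y = Nat.card {z : Submodule F W // y ⋖ z} := by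
  classical
  simp [Matrix.mul_apply, L, R, Fintype.card_subtype, Nat.card_eq_fintype_card, ← ite_and]

theorem R_mul_L_apply_self (y : Submodule F W) :
    (R F W * L F W) y y = Nat.card {z : Submodule F W // z ⋖ y} := by
  classical
  simp [Matrix.mul_apply, L, R, Fintype.card_subtype, Nat.card_eq_fintype_card, ← ite_and]

/-- By modularity, two distinct subspaces have a common cover if and only if they cover a common
subspace; these are then their sum and their intersection. -/
theorem L_mul_R_apply_of_ne {y z : Submodule F W} (h : y ≠ z) :
    (L F W * R F W) y z = (R F W * L F W) y z := by
  classical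
  have h₁ : ∀ w, L F W y w * R F W w z =
      if w = y ⊔ z then (if y ⋖ y ⊔ z ∧ z ⋖ y ⊔ z then 1 else 0) else 0 := by
    intro w
    simp only [L, R, Matrix.of_apply]
    by_cases hw : w = y ⊔ z
    · subst hw
      by_cases h₁ : y ⋖ y ⊔ z <;> simp [h₁]
    · rw [if_neg hw]
      by_cases h₁ : y ⋖ w
      · have h₂ : ¬ z ⋖ w := fun h₂ => hw (CovBy.wcovBy h₁ |>.sup_eq h₂.wcovBy h).symm
        simp [h₂]
      · simp [h₁]
  have h₂ : ∀ w, R F W y w * L F W w z =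
      if w = y ⊓ z then (if y ⊓ z ⋖ y ∧ y ⊓ z ⋖ z then 1 else 0) else 0 := by
    intro w
    simp only [L, R, Matrix.of_apply]
    by_cases hw : w = y ⊓ z
    · subst hw
      by_cases h₁ : y ⊓ z ⋖ y <;> simp [h₁]
    · rw [if_neg hw]
      by_cases h₁ : w ⋖ y
      · have h₂ : ¬ w ⋖ z := fun h₂ => hw (CovBy.wcovBy h₁ |>.inf_eq h₂.wcovBy h).symm
        simp [h₂]
      · simp [h₁]
  have h₃ : (y ⋖ y ⊔ z ∧ z ⋖ y ⊔ z) ↔ (y ⊓ z ⋖ y ∧ y ⊓ z ⋖ z) :=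
    ⟨fun h => ⟨inf_covBy_of_covBy_sup_right h.2, inf_covBy_of_covBy_sup_left h.1⟩,
      fun h => ⟨covBy_sup_of_inf_covBy_right h.2, covBy_sup_of_inf_covBy_left h.1⟩⟩
  simp only [Matrix.mul_apply, h₁, h₂, Finset.sum_ite_eq', Finset.mem_univ, if_true, h₃]

variable (F W)

open Classical in
/-- The off-diagonal entries of `L R - R L` vanish by modularity; the diagonal ones are differences
of the numbers of subspaces covering and covered by a given subspace. -/
theorem Astar_inv_mul_commutator :
    (Astar F W)⁻¹ * (L F W * R F W - R F W * L F W) =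
      (q F - 1)⁻¹ • (q F ^ finrank F W • 1 - (Astar F W)⁻¹ * (Astar F W)⁻¹) := by
  ext y z
  rw [Astar_inv, Matrix.diagonal_mul_diagonal, Matrix.diagonal_mul, Matrix.sub_apply,
    Matrix.smul_apply, Matrix.sub_apply, Matrix.smul_apply, smul_eq_mul, smul_eq_mul]
  by_cases h : y = z
  · subst h
    rw [L_mul_R_apply_self, R_mul_L_apply_self, Matrix.one_apply_eq, Matrix.diagonal_apply_eq,
      eq_inv_mul_iff_mul_eq₀ (q_sub_one_ne_zero F)]
    have h₁ := card_covering y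
    have h₂ := card_covered y
    have h₃ : q F ^ finrank F y * q F ^ (finrank F W - finrank F y) = q F ^ finrank F W := by
      rw [← pow_add, Nat.add_sub_cancel' y.finrank_le]
    linear_combination q F ^ finrank F y * (h₁ - h₂) + h₃
  · rw [L_mul_R_apply_of_ne h, Matrix.one_apply_ne h, Matrix.diagonal_apply_ne _ h]
    simp

open Classical in
theorem A_eq (φ : ℝ) : A F W φ = R F W + (φ : ℂ) • ((Astar F W)⁻¹ * L F W) +
    (((φ : ℂ) - 1) / (q F - 1)) • (Astar F W)⁻¹ := by
  ext y z
  rw [Matrix.add_apply, Matrix.add_apply, Matrix.smul_apply, Matrix.smul_apply, Astar_inv,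
    Matrix.diagonal_mul, A, R, L, Matrix.of_apply, Matrix.of_apply, Matrix.of_apply,
    Matrix.diagonal_apply]
  by_cases h₁ : z ⋖ y
  · have h₂ : ¬ y ⋖ z := fun h => h₁.lt.asymm h.lt
    simp [h₁, h₂, h₁.ne']
  · by_cases h₂ : y ⋖ z
    · simp [h₁, h₂, h₂.ne]
    · by_cases h₃ : y = z <;> simp [h₁, h₂, h₃]

open Classical in
theorem A_eq_sup (φ : ℝ) :
    A F W φ = (φ : ℂ) • Asup_minus F W + (-1 : ℂ) • Asup_plus F W := by
  rw [A_eq, Asup_minus, Asup_plus, div_eq_mul_inv]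
  module

open Classical in
theorem A_eq_sub {φ : ℝ} (hφ : φ ≠ 0) :
    A F W φ = (-1 : ℂ) • Asub_minus F W φ + (φ : ℂ) • Asub_plus F W φ := by
  have h : (φ : ℂ) * (φ : ℂ)⁻¹ = 1 := mul_inv_cancel₀ (Complex.ofReal_ne_zero.2 hφ)
  rw [A_eq, Asub_minus, Asub_plus, div_eq_mul_inv, smul_add (φ : ℂ), smul_smul (φ : ℂ) (φ : ℂ)⁻¹,
    h]
  module

end Matrices

/-! ### Primitive idempotents -/

section PrimitiveIdempotents

variable {X : Type*} [Fintype X] {B : Matrix X X ℂ}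

/-- The decidability instance on the index set, fixed in the definition of `eigSpace`, is
irrelevant. -/
theorem eigSpace_eq [DecidableEq X] (B : Matrix X X ℂ) (μ : ℂ) :
    eigSpace B μ = eigenspace (Matrix.toLin' B) μ := by
  rw [eigSpace]
  congr!

theorem mem_imageSpace {v : X → ℂ} : v ∈ imageSpace B ↔ ∃ w, B.mulVec w = v := by
  classical
  simp [imageSpace]

theorem IsPrimitiveIdempotent.imageSpace_eq {θ : ℂ} {E : Matrix X X ℂ}
    (h : IsPrimitiveIdempotent B θ E) : imageSpace E = eigSpace B θ := by
  classical
  apply le_antisymm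
  · rw [imageSpace, LinearMap.range_eq_map, ← h.diagonalizable, Submodule.map_iSup]
    refine iSup_le fun μ => ?_
    rintro _ ⟨v, hv, rfl⟩
    rw [Matrix.toLin'_apply]
    by_cases hμ : μ = θ
    · subst hμ
      rwa [h.apply_self v hv]
    · rw [h.apply_other μ hμ v hv]
      exact zero_mem _
  · intro v hv
    exact ⟨v, (Matrix.toLin'_apply _ _).trans (h.apply_self v hv)⟩

/-- The primitive idempotents are the Lagrange interpolation polynomials of the eigenvalues,
evaluated at the matrix. -/
theorem existsUnique_isPrimitiveIdempotent {ι : Type*} [Fintype ι] {θ : ι → ℂ}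
    (hθ : Function.Injective θ) (htop : ⨆ i, eigSpace B (θ i) = ⊤)
    (hne : ∀ i, eigSpace B (θ i) ≠ ⊥) :
    ∃! E : ι → Matrix X X ℂ, ∀ i, IsPrimitiveIdempotent B (θ i) (E i) := by
  classical
  have hdiag : IsDiagonalizable B :=
    top_unique (htop.symm.le.trans (iSup_le fun i => le_iSup (eigSpace B) (θ i)))
  have happly : ∀ i μ, ∀ v ∈ eigSpace B μ,
      (LinearMap.toMatrix' (Polynomial.aeval (Matrix.toLin' B)
        (Lagrange.basis Finset.univ θ i))).mulVec v =
        (Lagrange.basis Finset.univ θ i).eval μ • v := by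
    intro i μ v hv
    rw [← Matrix.toLin'_apply, Matrix.toLin'_toMatrix']
    by_cases hv0 : v = 0
    · simp [hv0]
    · exact aeval_apply_of_hasEigenvector ⟨hv, hv0⟩
  refine ⟨fun i => LinearMap.toMatrix' (Polynomial.aeval (Matrix.toLin' B)
    (Lagrange.basis Finset.univ θ i)), fun i => ⟨hdiag, hne i, fun v hv => ?_,
      fun μ hμ v hv => ?_⟩, fun E hE => ?_⟩
  · rw [happly i _ v hv, Lagrange.eval_basis_self hθ.injOn (Finset.mem_univ i), one_smul]
  · by_cases h : ∃ j, θ j = μ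
    · obtain ⟨j, rfl⟩ := h
      rw [happly i _ v hv, Lagrange.eval_basis_of_ne (fun h => hμ (by rw [h])) (Finset.mem_univ j),
        zero_smul]
    · have h₁ : eigSpace B μ = ⊥ :=
        eigenspace_eq_bot_of_iSup_eq_top htop fun i hi => h ⟨i, hi⟩
      rw [h₁, Submodule.mem_bot] at hv
      rw [hv, Matrix.mulVec_zero]
  · funext i
    apply Matrix.toLin'.injective
    have key : (⨆ j, eigSpace B (θ j)) ≤ LinearMap.eqLocus (Matrix.toLin' (E i))
        (Polynomial.aeval (Matrix.toLin' B) (Lagrange.basis Finset.univ θ i)) := by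
      refine iSup_le fun j v hv => ?_
      have h := happly i _ v hv
      rw [← Matrix.toLin'_apply, Matrix.toLin'_toMatrix'] at h
      rw [LinearMap.mem_eqLocus, h, Matrix.toLin'_apply]
      by_cases hij : i = j
      · subst hij
        rw [(hE i).apply_self v hv, Lagrange.eval_basis_self hθ.injOn (Finset.mem_univ i),
          one_smul]
      · rw [(hE i).apply_other _ (fun h => hij (hθ h).symm) v hv,
          Lagrange.eval_basis_of_ne hij (Finset.mem_univ j), zero_smul]
    rw [Matrix.toLin'_toMatrix']
    ext1 v
    exact LinearMap.ext fun w => key (htop.symm ▸ Submodule.mem_top : _ ∈ _)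

end PrimitiveIdempotents

/-! ### The standard module and its four split decompositions -/

section StandardModule

theorem theta_rev_eq (F : Type*) {N : ℕ} (φ : ℝ) (j : Fin (N + 1)) : theta F φ N (j.rev : ℕ) =
    ((φ : ℂ) * q F ^ (j : ℕ) + (-1) * q F ^ (N - (j : ℕ))) / (q F - 1) := by
  have h : (j.rev : ℕ) = N - j := by rw [Fin.val_rev]; omega
  rw [theta, h, Nat.sub_sub_self (Nat.lt_succ_iff.1 j.2)]
  ring

theorem theta_eq (F : Type*) {N : ℕ} (φ : ℝ) (j : Fin (N + 1)) : theta F φ N (j : ℕ) =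
    ((-1) * q F ^ (j : ℕ) + (φ : ℂ) * q F ^ (N - (j : ℕ))) / (q F - 1) := by
  rw [theta]
  ring

variable (F W : Type*) [Field F] [Finite F] [AddCommGroup W] [Module F W] [FiniteDimensional F W]

open Classical in
theorem mem_eigenspace_Astar_inv_iff {i : ℕ} {v : Std F W} :
    v ∈ eigenspace (Matrix.toLin' (Astar F W)⁻¹) (1 * q F ^ i) ↔
      ∀ y : Submodule F W, finrank F y ≠ i → v y = 0 := by
  rw [mem_eigenspace_iff, Matrix.toLin'_apply, Astar_inv, one_mul, funext_iff]
  refine forall_congr' fun y => ?_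
  rw [Matrix.mulVec_diagonal, Pi.smul_apply, smul_eq_mul, mul_eq_mul_right_iff,
    (q_pow_injective F).eq_iff]
  tauto

open Classical in
/-- The projection onto dimension `i` has as its image an eigenspace of `(A*)⁻¹`. -/
theorem imageSpace_Estar (i : ℕ) :
    imageSpace (Estar F W i) = eigenspace (Matrix.toLin' (Astar F W)⁻¹) (1 * q F ^ i) := by
  ext v
  rw [mem_eigenspace_Astar_inv_iff]
  constructor
  · rw [mem_imageSpace]
    rintro ⟨w, rfl⟩ y hy
    rw [Estar, Matrix.mulVec_diagonal, if_neg hy, zero_mul]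
  · intro hv
    refine mem_imageSpace.2 ⟨v, funext fun y => ?_⟩
    rw [Estar, Matrix.mulVec_diagonal]
    split_ifs with hy
    · rw [one_mul]
    · rw [zero_mul, hv y hy]

open Classical in
theorem Asub_minus_eq (φ : ℝ) : Asub_minus F W φ =
    (q F - 1)⁻¹ • (Astar F W)⁻¹ + (-(φ : ℂ)) • ((Astar F W)⁻¹ * L F W) := by
  rw [Asub_minus, neg_smul, sub_eq_add_neg]

open Classical in
theorem Asub_plus_eq (φ : ℝ) : Asub_plus F W φ =
    (q F - 1)⁻¹ • (Astar F W)⁻¹ - (-(φ : ℂ))⁻¹ • R F W := by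
  rw [Asub_plus, inv_neg, neg_smul, sub_neg_eq_add]

open Classical in
theorem isGraded_standard {N : ℕ} (hW : finrank F W = N) :
    IsGraded (q F) N (Matrix.toLin' (Astar F W)⁻¹) (Matrix.toLin' (R F W))
      (Matrix.toLin' ((Astar F W)⁻¹ * L F W)) where
  ne_zero := q_ne_zero F
  pow_injective := q_pow_injective F
  raising := by
    rw [End.mul_eq_comp, End.mul_eq_comp, ← Matrix.toLin'_mul, ← Matrix.toLin'_mul, ← map_smul,
      Astar_inv_mul_R]
  lowering := by
    rw [End.mul_eq_comp, End.mul_eq_comp, ← Matrix.toLin'_mul, ← Matrix.toLin'_mul, ← map_smul,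
      Matrix.mul_assoc, L_mul_Astar_inv, Matrix.mul_smul]
  comm := by
    have h := Astar_inv_mul_commutator F W
    rw [hW, Matrix.mul_sub, ← Matrix.mul_assoc, ← Matrix.mul_assoc, Astar_inv_mul_R,
      Matrix.smul_mul, Matrix.mul_assoc (R F W)] at h
    have h' := congrArg Matrix.toLin' h
    simp only [map_sub, map_smul, Matrix.toLin'_mul, Matrix.toLin'_one] at h'
    simpa only [End.mul_eq_comp, Matrix.toLin'_mul, End.one_eq_id] using h'
  iSup_eq_top := by
    refine eq_top_iff.2 fun v _ => ?_
    have h : v = ∑ i : Fin (N + 1), fun y : Submodule F W =>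
        if finrank F y = (i : ℕ) then v y else 0 := by
      funext y
      rw [Finset.sum_apply, Finset.sum_eq_single
        (⟨finrank F y, Nat.lt_succ_of_le (hW ▸ y.finrank_le)⟩ : Fin (N + 1))]
      · simp
      · intro i _ hi
        exact if_neg fun h => hi (Fin.ext h.symm)
      · simp
    rw [h]
    refine Submodule.sum_mem _ fun i _ => Submodule.mem_iSup_of_mem i ?_
    rw [mem_eigenspace_Astar_inv_iff]
    exact fun y hy => if_neg hy
  ne_bot := by
    intro i
    obtain ⟨y, hy⟩ := exists_submodule_finrank_eq (F := F) (W := W) (i := i) (by omega)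
    refine (Submodule.ne_bot_iff _).2 ⟨Pi.single y 1, ?_, by simp⟩
    rw [mem_eigenspace_Astar_inv_iff]
    intro z hz
    rw [Pi.single_eq_of_ne]
    rintro rfl
    exact hz hy

section Operators

open Classical in
theorem Udd_eq (i : ℕ) : Udd F W i = eigenspace
    ((q F - 1)⁻¹ • Matrix.toLin' (Astar F W)⁻¹ + Matrix.toLin' ((Astar F W)⁻¹ * L F W))
    ((q F - 1)⁻¹ * q F ^ i) := by
  rw [Udd, eigSpace_eq, Asup_minus, map_add, map_smul, div_eq_inv_mul]

open Classical in
theorem Uud_eq (i : ℕ) : Uud F W i = eigenspace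
    ((q F - 1)⁻¹ • Matrix.toLin' (Astar F W)⁻¹ - Matrix.toLin' (R F W))
    ((q F - 1)⁻¹ * q F ^ i) := by
  rw [Uud, eigSpace_eq, Asup_plus, map_sub, map_smul, div_eq_inv_mul]

open Classical in
theorem Udu_eq (φ : ℝ) (i : ℕ) : Udu F W φ i = eigenspace
    ((q F - 1)⁻¹ • Matrix.toLin' (Astar F W)⁻¹ +
      Matrix.toLin' ((-(φ : ℂ)) • ((Astar F W)⁻¹ * L F W)))
    ((q F - 1)⁻¹ * q F ^ i) := by
  rw [Udu, eigSpace_eq, Asub_minus_eq, map_add, map_smul, div_eq_inv_mul]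

open Classical in
theorem Uuu_eq (φ : ℝ) (i : ℕ) : Uuu F W φ i = eigenspace
    ((q F - 1)⁻¹ • Matrix.toLin' (Astar F W)⁻¹ - Matrix.toLin' ((-(φ : ℂ))⁻¹ • R F W))
    ((q F - 1)⁻¹ * q F ^ i) := by
  rw [Uuu, eigSpace_eq, Asub_plus_eq, map_sub, map_smul, div_eq_inv_mul]

open Classical in
theorem toLin'_A_eq_sup (φ : ℝ) : Matrix.toLin' (A F W φ) = (φ : ℂ) •
    ((q F - 1)⁻¹ • Matrix.toLin' (Astar F W)⁻¹ + Matrix.toLin' ((Astar F W)⁻¹ * L F W)) +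
    (-1 : ℂ) • ((q F - 1)⁻¹ • Matrix.toLin' (Astar F W)⁻¹ - Matrix.toLin' (R F W)) := by
  rw [A_eq_sup, Asup_minus, Asup_plus]
  simp only [map_add, map_sub, map_smul]

open Classical in
theorem toLin'_A_eq_sub {φ : ℝ} (hφ : φ ≠ 0) : Matrix.toLin' (A F W φ) = (-1 : ℂ) •
    ((q F - 1)⁻¹ • Matrix.toLin' (Astar F W)⁻¹ +
      Matrix.toLin' ((-(φ : ℂ)) • ((Astar F W)⁻¹ * L F W))) +
    (φ : ℂ) • ((q F - 1)⁻¹ • Matrix.toLin' (Astar F W)⁻¹ -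
      Matrix.toLin' ((-(φ : ℂ))⁻¹ • R F W)) := by
  rw [A_eq_sub F W hφ, Asub_minus_eq, Asub_plus_eq, map_add, map_smul, map_smul, map_add, map_sub,
    map_smul Matrix.toLin' (q F - 1)⁻¹]

end Operators

open Classical in
/-- The factor `-φ` turns the pair `(A⁺, A⁻)` into the pair `(A₊, A₋)`. -/
theorem isGraded_standard_rescaled {N : ℕ} (hW : finrank F W = N) {φ : ℝ} (hφ : 0 < φ) :
    IsGraded (q F) N (Matrix.toLin' (Astar F W)⁻¹) (Matrix.toLin' ((-(φ : ℂ))⁻¹ • R F W))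
      (Matrix.toLin' ((-(φ : ℂ)) • ((Astar F W)⁻¹ * L F W))) := by
  rw [map_smul, map_smul]
  exact (isGraded_standard F W hW).rescale (neg_ne_zero.2 (Complex.ofReal_ne_zero.2 hφ.ne'))

/-- As `φ > 0`, the real numbers `φ q ^ (N - i) - q ^ i` decrease strictly with `i`. -/
theorem theta_injective {φ : ℝ} (hφ : 0 < φ) (N : ℕ) :
    Function.Injective fun i : Fin (N + 1) => theta F φ N i := by
  have hq : (1 : ℝ) < Nat.card F := by exact_mod_cast Finite.one_lt_card (α := F)
  have hanti : StrictAnti fun i : Fin (N + 1) =>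
      φ * (Nat.card F : ℝ) ^ (N - (i : ℕ)) - (Nat.card F : ℝ) ^ (i : ℕ) := by
    intro i j hij
    have h₁ : (Nat.card F : ℝ) ^ (N - (j : ℕ)) ≤ (Nat.card F : ℝ) ^ (N - (i : ℕ)) :=
      pow_le_pow_right₀ hq.le (Nat.sub_le_sub_left hij.le _)
    have h₂ : (Nat.card F : ℝ) ^ (i : ℕ) < (Nat.card F : ℝ) ^ (j : ℕ) :=
      pow_lt_pow_right₀ hq hij
    have h₃ := mul_le_mul_of_nonneg_left h₁ hφ.le
    dsimp only
    linarith
  intro i j h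
  apply hanti.injective
  have h' := (div_left_inj' (q_sub_one_ne_zero F)).1 h
  simp only [q] at h'
  exact_mod_cast h'

section Flags

variable {N : ℕ} {φ : ℝ}

variable (hW : finrank F W = N) (hφ : 0 < φ)
include hW hφ

theorem iSup_eigSpace_A : ⨆ j : Fin (N + 1), eigSpace (A F W φ) (theta F φ N j) = ⊤ := by
  classical
  have h := (isGraded_standard_rescaled F W hW hφ).combination_iSup_eq_top
    (theta_injective F hφ N) (theta_eq F φ)
  simp only [eigSpace_eq, toLin'_A_eq_sub F W hφ.ne']
  exact h

theorem eigSpace_A_ne_bot (i : Fin (N + 1)) : eigSpace (A F W φ) (theta F φ N i) ≠ ⊥ := by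
  classical
  have h := (isGraded_standard_rescaled F W hW hφ).combination_ne_bot i
    (theta_injective F hφ N) (theta_eq F φ)
  rw [eigSpace_eq, toLin'_A_eq_sub F W hφ.ne']
  exact h

theorem Udd_eq_inf (i : Fin (N + 1)) : Udd F W i =
    (⨆ (j : Fin (N + 1)) (_ : j ≤ i), imageSpace (Estar F W j)) ⊓
      ⨆ (j : Fin (N + 1)) (_ : i ≤ j), eigSpace (A F W φ) (theta F φ N j.rev) := by
  classical
  have h := (isGraded_standard F W hW).lower_eigenspace_eq_inf i
    ((theta_injective F hφ N).comp Fin.rev_injective) (theta_rev_eq F φ)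
  simp only [Udd_eq, imageSpace_Estar, eigSpace_eq, toLin'_A_eq_sup]
  exact h

theorem Uud_eq_inf (i : Fin (N + 1)) : Uud F W i =
    (⨆ (j : Fin (N + 1)) (_ : i ≤ j), imageSpace (Estar F W j)) ⊓
      ⨆ (j : Fin (N + 1)) (_ : j ≤ i), eigSpace (A F W φ) (theta F φ N j) := by
  classical
  have h := (isGraded_standard F W hW).upper_eigenspace_eq_inf i
    ((theta_injective F hφ N).comp Fin.rev_injective) (theta_rev_eq F φ)
  simp only [Function.comp_apply, Fin.rev_rev] at h
  simp only [Uud_eq, imageSpace_Estar, eigSpace_eq, toLin'_A_eq_sup]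
  exact h

theorem Udu_eq_inf (i : Fin (N + 1)) : Udu F W φ i =
    (⨆ (j : Fin (N + 1)) (_ : j ≤ i), imageSpace (Estar F W j)) ⊓
      ⨆ (j : Fin (N + 1)) (_ : i ≤ j), eigSpace (A F W φ) (theta F φ N j) := by
  classical
  have h := (isGraded_standard_rescaled F W hW hφ).lower_eigenspace_eq_inf i
    (theta_injective F hφ N) (theta_eq F φ)
  simp only [Udu_eq, imageSpace_Estar, eigSpace_eq, toLin'_A_eq_sub F W hφ.ne']
  exact h

theorem Uuu_eq_inf (i : Fin (N + 1)) : Uuu F W φ i =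
    (⨆ (j : Fin (N + 1)) (_ : i ≤ j), imageSpace (Estar F W j)) ⊓
      ⨆ (j : Fin (N + 1)) (_ : j ≤ i), eigSpace (A F W φ) (theta F φ N j.rev) := by
  classical
  have h := (isGraded_standard_rescaled F W hW hφ).upper_eigenspace_eq_inf i
    (theta_injective F hφ N) (theta_eq F φ)
  simp only [Uuu_eq, imageSpace_Estar, eigSpace_eq, toLin'_A_eq_sub F W hφ.ne']
  exact h

end Flags

theorem isDecomposition_of_eigenspace {M : Type*} [AddCommGroup M] [Module ℂ M] {T : End ℂ M}
    {N : ℕ} {U : ℕ → Submodule ℂ M} {c : Fin (N + 1) → ℂ} (hc : Function.Injective c)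
    (hU : ∀ i : Fin (N + 1), U i = eigenspace T (c i)) (htop : ⨆ i, eigenspace T (c i) = ⊤)
    (hne : ∀ i, eigenspace T (c i) ≠ ⊥) : IsDecomposition N U := by
  refine ⟨fun i hi => ?_, ?_⟩
  · rw [show U i = _ from hU ⟨i, Nat.lt_succ_of_le hi⟩]
    exact hne _
  · simp_rw [hU]
    exact DirectSum.isInternal_submodule_of_iSupIndep_of_iSup_eq_top
      (iSupIndep_eigenspace_comp T hc) htop

theorem iSup_comp_rev {α : Type*} [CompleteLattice α] {n : ℕ} (f : Fin n → α) (P : Fin n → Prop) :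
    ⨆ (j) (_ : P j), f j.rev = ⨆ (j) (_ : P j.rev), f j :=
  Fin.revPerm.iSup_congr fun j => by simp

end StandardModule

end ProjGeom

theorem theorem15p17 (F W : Type*) [Field F] [Finite F] [AddCommGroup W] [Module F W]
    [FiniteDimensional F W] (N : ℕ) (hN : 1 ≤ N) (hW : Module.finrank F W = N)
    (φ : ℝ) (hφ : 0 < φ) :
    -- the four sequences of eigenspaces are decompositions of the standard module
    (ProjGeom.IsDecomposition N (ProjGeom.Udd F W) ∧
      ProjGeom.IsDecomposition N (ProjGeom.Uud F W) ∧
      ProjGeom.IsDecomposition N (ProjGeom.Udu F W φ) ∧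
      ProjGeom.IsDecomposition N (ProjGeom.Uuu F W φ)) ∧
    -- the primitive idempotents of `A` for `θ_0, …, θ_N` exist and are unique
    (∃! E : Fin (N + 1) → ProjGeom.Mat F W, ∀ i : Fin (N + 1),
      ProjGeom.IsPrimitiveIdempotent (ProjGeom.A F W φ) (ProjGeom.theta F φ N i) (E i)) ∧
    -- the four descriptions as intersections
    ∀ E : Fin (N + 1) → ProjGeom.Mat F W,
      (∀ i : Fin (N + 1),
        ProjGeom.IsPrimitiveIdempotent (ProjGeom.A F W φ) (ProjGeom.theta F φ N i) (E i)) →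
      ∀ i : Fin (N + 1),
        (ProjGeom.Udd F W i =
          (⨆ (j : Fin (N + 1)) (_ : j ≤ i), ProjGeom.imageSpace (ProjGeom.Estar F W j)) ⊓
          (⨆ (j : Fin (N + 1)) (_ : (j : ℕ) ≤ N - i), ProjGeom.imageSpace (E j))) ∧
        (ProjGeom.Uud F W i =
          (⨆ (j : Fin (N + 1)) (_ : i ≤ j), ProjGeom.imageSpace (ProjGeom.Estar F W j)) ⊓
          (⨆ (j : Fin (N + 1)) (_ : j ≤ i), ProjGeom.imageSpace (E j))) ∧
        (ProjGeom.Udu F W φ i =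
          (⨆ (j : Fin (N + 1)) (_ : j ≤ i), ProjGeom.imageSpace (ProjGeom.Estar F W j)) ⊓
          (⨆ (j : Fin (N + 1)) (_ : i ≤ j), ProjGeom.imageSpace (E j))) ∧
        (ProjGeom.Uuu F W φ i =
          (⨆ (j : Fin (N + 1)) (_ : i ≤ j), ProjGeom.imageSpace (ProjGeom.Estar F W j)) ⊓
          (⨆ (j : Fin (N + 1)) (_ : N - i ≤ (j : ℕ)), ProjGeom.imageSpace (E j))) := by
  open ProjGeom in
  classical
  have hθ := theta_injective F hφ N
  have h := isGraded_standard F W hW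
  have h' := isGraded_standard_rescaled F W hW hφ
  have hinj := geometric_injective (N := N) h.pow_injective h.inv_sub_one_ne_zero
  refine ⟨⟨?_, ?_, ?_, ?_⟩, ?_, fun E hE i => ?_⟩
  · exact isDecomposition_of_eigenspace hinj (fun i => Udd_eq F W i)
      h.lower_iSup_eq_top h.lower_ne_bot
  · exact isDecomposition_of_eigenspace hinj (fun i => Uud_eq F W i)
      h.upper_iSup_eq_top h.upper_ne_bot
  · exact isDecomposition_of_eigenspace hinj (fun i => Udu_eq F W φ i)
      h'.lower_iSup_eq_top h'.lower_ne_bot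
  · exact isDecomposition_of_eigenspace hinj (fun i => Uuu_eq F W φ i)
      h'.upper_iSup_eq_top h'.upper_ne_bot
  · exact existsUnique_isPrimitiveIdempotent hθ (iSup_eigSpace_A F W hW hφ)
      (eigSpace_A_ne_bot F W hW hφ)
  · have hEA : ∀ j : Fin (N + 1), eigSpace (A F W φ) (theta F φ N j) = imageSpace (E j) :=
      fun j => (hE j).imageSpace_eq.symm
    have hle : ∀ j : Fin (N + 1), (i ≤ j.rev ↔ (j : ℕ) ≤ N - i) := fun j => by
      rw [Fin.le_def, Fin.val_rev]
      omega
    have hge : ∀ j : Fin (N + 1), (j.rev ≤ i ↔ N - i ≤ (j : ℕ)) := fun j => by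
      rw [Fin.le_def, Fin.val_rev]
      omega
    have hle' := iSup_comp_rev (fun j => imageSpace (E j)) (i ≤ ·)
    have hge' := iSup_comp_rev (fun j => imageSpace (E j)) (· ≤ i)
    -- the flags of `A` indexed through `Fin.rev` are those bounded by `N - i`
    simp only [hle] at hle'
    simp only [hge] at hge'
    refine ⟨?_, ?_, ?_, ?_⟩
    · simp only [Udd_eq_inf F W hW hφ, hEA, hle']
    · simp only [Uud_eq_inf F W hW hφ, hEA]
    · simp only [Udu_eq_inf F W hW hφ, hEA]
    · simp only [Uuu_eq_inf F W hW hφ, hEA, hge']
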